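/- **Setting.** All manifolds are $C^\infty$, Hausdorff and without boundary, all vector fields are $C^\infty$, and $\nabla$ denotes the Levi-Civita connection of $(M,g_M)$. A *cosymplectic manifold* $M(\phi,\xi,\eta,g_M)$ is a Riemannian manifold $(M,g_M)$ with a smooth $(1,1)$-tensor field $\phi$, a smooth vector field $\xi$ and a smooth $1$-form $\eta$ such that $$\phi^2=-I+\eta\otimes\xi,\quad \phi\xi=0,\quad \eta\circ\phi=0,\quad \eta(\xi)=1,\quad g_M(\phi X,\phi Y)=g_M(X,Y)-\eta(X)\eta(Y),\quad \eta(X)=g_M(X,\xi),$$ which is normal, i.e. $[\phi,\phi]+2\,d\eta\otimes\xi=0$ with $[\phi,\phi]$ the Nijenhuis tensor of $\phi$ and $2\,d\eta(X,Y)=X\eta(Y)-Y\eta(X)-\eta([X,Y])$, and for which the forms $\eta$ and $\Phi(X,Y)=g_M(X,\phi Y)$ are closed. A *Riemannian submersion* $F:(M,g_M)\to(N,g_N)$ is a smooth surjective map between Riemannian manifolds whose differential $F_*$ is surjective at every point and preserves the lengths of horizontal vectors, i.e. of the vectors in $(\ker F_*)^\perp$. The vectors in $\ker F_*$ are called vertical,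 and $\mathcal V,\mathcal H$ denote the orthogonal projections onto $\ker F_*$ and $(\ker F_*)^\perp$. $F$ is *anti-invariant* if $\phi(\ker F_*)\subseteq(\ker F_*)^\perp$. For horizontal $X$ write $\phi X=BX+CX$ with $BX$ vertical and $CX$ horizontal. Let $$\mathcal A_EG=\mathcal V\nabla_{\mathcal HE}\mathcal HG+\mathcal H\nabla_{\mathcal HE}\mathcal VG,\qquad (\nabla F_*)(E,G)=\nabla^F_E F_*G-F_*(\nabla_EG)$$ be O'Neill's tensor and the second fundamental form of $F$, where $\nabla^F$ is the pullback along $F$ of the Levi-Civita connection of $N$. The distribution $(\ker F_*)^\perp$ is *integrable* if $[X,Y]$ is horizontal for all horizontal vector fields $X,Y$. **Theorem 3.** Let $F$ be an anti-invariant Riemannian submersion from a cosymplectic manifold $M(\phi,\xi,\eta,g_M)$ to a Riemannian manifold $(N,g_N)$ such that $\xi$ is vertical. Then the following assertions are equivalent: (i) $(\ker F_*)^\perp$ is integrable; (ii) for all horizontal vector fields $X,Y$ and all vertical vector fields $V$, $$g_N\big((\nabla F_*)(Y,BX),F_*\phi V\big)=g_N\big((\nabla F_*)(X,BY),F_*\phi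 V\big)+g_M(CY,\phi\mathcal A_XV)-g_M(CX,\phi\mathcal A_YV);$$ (iii) for all horizontal vector fields $X,Y$ and all vertical vector fields $V$, $$g_M(\mathcal A_XBY-\mathcal A_YBX,\phi V)=g_M(CY,\phi\mathcal A_XV)-g_M(CX,\phi\mathcal A_YV).$$ -/

import Mathlib

open Bundle Manifold VectorField Module
open scoped ContDiff

noncomputable section

namespace RiemSubm
variable {E : Type*} [NormedAddCommGroup E] [NormedSpace ℝ E] [FiniteDimensional ℝ E]
  {H : Type*} [TopologicalSpace H] {I : ModelWithCorners ℝ E H}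
  {M : Type*} [TopologicalSpace M] [ChartedSpace H M] [IsManifold I ∞ M]
  [RiemannianBundle (fun x : M ↦ TangentSpace I x)]
  [IsContMDiffRiemannianBundle I ∞ E (fun x : M ↦ TangentSpace I x)]

/-- The tangent spaces are finite dimensional. -/
instance finiteDimensional_tangentSpace (x : M) : FiniteDimensional ℝ (TangentSpace I x) :=
  inferInstanceAs (FiniteDimensional ℝ E)

/-- The right-hand side of the Koszul formula for `⟪∇_X Y, Z⟫` at `x`. -/
def koszul (X Y Z : Π x : M, TangentSpace I x) (x : M) : ℝ :=
  (1 / 2 : ℝ) * (mvfderiv I (fun y ↦ inner ℝ (Y y) (Z y)) x (X x)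
    + mvfderiv I (fun y ↦ inner ℝ (X y) (Z y)) x (Y x)
    - mvfderiv I (fun y ↦ inner ℝ (X y) (Y y)) x (Z x)
    + inner ℝ (mlieBracket I X Y x) (Z x)
    - inner ℝ (mlieBracket I X Z x) (Y x)
    - inner ℝ (mlieBracket I Y Z x) (X x))

theorem mdiff_inner {X Y : Π x : M, TangentSpace I x} {x : M}
    (hX : MDiffAt (T% X) x) (hY : MDiffAt (T% Y) x) :
    MDiffAt (fun y ↦ inner ℝ (X y) (Y y)) x :=
  MDifferentiableAt.inner_bundle (F := E) (E := fun x : M ↦ TangentSpace I x) (b := id) hX hY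

theorem koszul_tensorial_left {x : M} {Y Z : Π x : M, TangentSpace I x}
    (hY : MDiffAt (T% Y) x) (hZ : MDiffAt (T% Z) x) :
    TensorialAt I E (fun X ↦ koszul X Y Z x) x where
  smul {f X} hf hX := by
    have h1 := mvfderiv_fun_mul hf (mdiff_inner hX hZ)
    have h2 := mvfderiv_fun_mul hf (mdiff_inner hX hY)
    simp only [koszul, Pi.smul_apply', real_inner_smul_left, h1, h2,
      mlieBracket_smul_left hf hX, inner_add_left, real_inner_smul_right]
    simp
    rw [real_inner_comm (Y x) (X x), real_inner_comm (Z x) (X x)]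
    ring
  add {X X'} hX hX' := by
    have h1 := mvfderiv_fun_add (mdiff_inner hX hZ) (mdiff_inner hX' hZ)
    have h2 := mvfderiv_fun_add (mdiff_inner hX hY) (mdiff_inner hX' hY)
    simp only [koszul, Pi.add_apply, inner_add_left, h1, h2, mlieBracket_add_left hX hX',
      inner_add_right]
    simp
    ring

theorem koszul_tensorial_right {x : M} {X Y : Π x : M, TangentSpace I x}
    (hX : MDiffAt (T% X) x) (hY : MDiffAt (T% Y) x) :
    TensorialAt I E (fun Z ↦ koszul X Y Z x) x where
  smul {f Z} hf hZ := by
    have h1 := mvfderiv_fun_mul hf (mdiff_inner hX hZ)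
    have h2 := mvfderiv_fun_mul hf (mdiff_inner hY hZ)
    simp only [koszul, Pi.smul_apply', real_inner_smul_right, h1, h2,
      mlieBracket_smul_right hf hZ, inner_add_left, real_inner_smul_left]
    simp
    rw [real_inner_comm (Y x) (Z x), real_inner_comm (X x) (Z x)]
    ring
  add {Z Z'} hZ hZ' := by
    have h1 := mvfderiv_fun_add (mdiff_inner hX hZ) (mdiff_inner hX hZ')
    have h2 := mvfderiv_fun_add (mdiff_inner hY hZ) (mdiff_inner hY hZ')
    simp only [koszul, Pi.add_apply, inner_add_left, h1, h2, mlieBracket_add_right hZ hZ',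
      inner_add_right]
    simp
    ring

/-- For a field `Y` differentiable at `x`, the Koszul expression as a bilinear form on `T_x M` in the
values at `x` of the outer two arguments. -/
def koszulForm (Y : Π x : M, TangentSpace I x) (x : M) (hY : MDiffAt (T% Y) x) :
    TangentSpace I x →L[ℝ] TangentSpace I x →L[ℝ] ℝ :=
  TensorialAt.mkHom₂ (I := I) (F := E) (F' := E) (fun X Z ↦ koszul X Y Z x) x
    (fun _ hZ ↦ koszul_tensorial_left hY hZ) (fun _ hX ↦ koszul_tensorial_right hX hY)

theorem koszulForm_apply {X Y Z : Π x : M, TangentSpace I x} {x : M} (hX : MDiffAt (T% X) x)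
    (hY : MDiffAt (T% Y) x) (hZ : MDiffAt (T% Z) x) :
    koszulForm Y x hY (X x) (Z x) = koszul X Y Z x :=
  TensorialAt.mkHom₂_apply _ _ hX hZ

/-- The endomorphism of `T_x M` that represents a bilinear form: `⟪sharp x B v, w⟫ = B v w`. -/
def sharp (x : M) (B : TangentSpace I x →L[ℝ] TangentSpace I x →L[ℝ] ℝ) :
    TangentSpace I x →L[ℝ] TangentSpace I x :=
  LinearMap.toContinuousLinearMap
    { toFun := fun v ↦ (InnerProductSpace.toDual ℝ (TangentSpace I x)).symm (B v)
      map_add' := fun v w ↦ by simp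
      map_smul' := fun c v ↦ by simp }

theorem inner_sharp (x : M) (B : TangentSpace I x →L[ℝ] TangentSpace I x →L[ℝ] ℝ)
    (v w : TangentSpace I x) : inner ℝ (sharp x B v) w = B v w := by
  simp [sharp]

open Classical in
/-- `∇ Y` at `x` as the endomorphism `v ↦ ∇_v Y`, obtained from the Koszul formula
(with value `0` where the field `Y` is not differentiable). -/
def leviCivitaFun (Y : Π x : M, TangentSpace I x) (x : M) :
    TangentSpace I x →L[ℝ] TangentSpace I x :=
  if hY : MDiffAt (T% Y) x then sharp x (koszulForm Y x hY) else 0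

theorem inner_leviCivitaFun {X Y Z : Π x : M, TangentSpace I x} {x : M} (hX : MDiffAt (T% X) x)
    (hY : MDiffAt (T% Y) x) (hZ : MDiffAt (T% Z) x) :
    inner ℝ (leviCivitaFun Y x (X x)) (Z x) = koszul X Y Z x := by
  rw [leviCivitaFun, dif_pos hY, inner_sharp, koszulForm_apply hX hY hZ]

theorem ext_of_fields {x : M} {A B : TangentSpace I x →L[ℝ] TangentSpace I x}
    (h : ∀ X Z : Π x : M, TangentSpace I x, MDiffAt (T% X) x → MDiffAt (T% Z) x →
      inner ℝ (A (X x)) (Z x) = inner ℝ (B (X x)) (Z x)) : A = B := by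
  ext v
  refine ext_inner_right ℝ fun w ↦ ?_
  simpa using h (FiberBundle.extend E v) (FiberBundle.extend E w)
    (FiberBundle.mdifferentiableAt_extend ..) (FiberBundle.mdifferentiableAt_extend ..)

variable (I M) in
/-- The Levi-Civita connection of a Riemannian manifold. `leviCivita I M Y x (X x)` is
`(∇_X Y)(x)`. -/
def leviCivita : CovariantDerivative I E (fun x : M ↦ TangentSpace I x) where
  toFun := leviCivitaFun
  isCovariantDerivativeOnUniv :=
    { add := fun {Y Y' x} hY hY' _ ↦ ext_of_fields fun X Z hX hZ ↦ by
        rw [inner_leviCivitaFun hX (mdifferentiableAt_add_section hY hY') hZ,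
          add_apply, inner_add_left,
          inner_leviCivitaFun hX hY hZ, inner_leviCivitaFun hX hY' hZ]
        have h1 := mvfderiv_fun_add (mdiff_inner hX hY) (mdiff_inner hX hY')
        have h2 := mvfderiv_fun_add (mdiff_inner hY hZ) (mdiff_inner hY' hZ)
        simp only [koszul, Pi.add_apply, inner_add_left, h1, h2, mlieBracket_add_right hY hY',
          mlieBracket_add_left hY hY', inner_add_right]
        simp
        ring
      leibniz := fun {Y f x} hY hf _ ↦ ext_of_fields fun X Z hX hZ ↦ by
        rw [inner_leviCivitaFun hX (hf.smul_section hY) hZ,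
          add_apply, inner_add_left, smul_apply,
          real_inner_smul_left,
          inner_leviCivitaFun hX hY hZ]
        have h1 := mvfderiv_fun_mul hf (mdiff_inner hX hY)
        have h2 := mvfderiv_fun_mul hf (mdiff_inner hY hZ)
        simp only [koszul, Pi.smul_apply', inner_add_left, real_inner_smul_left,
          real_inner_smul_right, h1, h2, mlieBracket_smul_right hf hY,
          mlieBracket_smul_left hf hY]
        simp [real_inner_smul_left]
        rw [real_inner_comm (X x) (Y x)]
        ring }

/-- The Levi-Civita connection is torsion free. -/
theorem leviCivita_torsion : (leviCivita I M).torsion = 0 := by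
  rw [CovariantDerivative.torsion_eq_zero_iff]
  intro X Y x hX hY
  refine ext_inner_right ℝ fun w ↦ ?_
  have hZ : MDiffAt (T% (FiberBundle.extend E w : Π x : M, TangentSpace I x)) x :=
    FiberBundle.mdifferentiableAt_extend ..
  have h1 := inner_leviCivitaFun hX hY hZ
  have h2 := inner_leviCivitaFun hY hX hZ
  simp only [FiberBundle.extend_apply_self] at h1 h2
  change inner ℝ (leviCivitaFun Y x (X x) - leviCivitaFun X x (Y x)) w = _
  rw [inner_sub_left, h1, h2]
  simp only [koszul]
  rw [mlieBracket_swap_apply (V := Y) (W := X)]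
  simp only [inner_neg_left, real_inner_comm, FiberBundle.extend_apply_self]
  ring

/-- The Levi-Civita connection is compatible with the metric. -/
theorem leviCivita_metric {X Y Z : Π x : M, TangentSpace I x} {x : M} (hX : MDiffAt (T% X) x)
    (hY : MDiffAt (T% Y) x) (hZ : MDiffAt (T% Z) x) :
    mvfderiv I (fun y ↦ inner ℝ (Y y) (Z y)) x (X x) =
      inner ℝ (leviCivita I M Y x (X x)) (Z x) + inner ℝ (Y x) (leviCivita I M Z x (X x)) := by
  have h1 := inner_leviCivitaFun hX hY hZ
  have h2 := inner_leviCivitaFun hX hZ hY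
  change _ = inner ℝ (leviCivitaFun Y x (X x)) (Z x) + inner ℝ (Y x) (leviCivitaFun Z x (X x))
  rw [real_inner_comm _ (Y x), h1, h2]
  simp only [koszul]
  rw [mlieBracket_swap_apply (V := Z) (W := Y)]
  simp only [inner_neg_left, real_inner_comm]
  ring

variable (I) in
/-- A smooth vector field on `M`. -/
def IsSmoothField (X : Π x : M, TangentSpace I x) : Prop :=
  ContMDiff I I.tangent ∞ (fun x ↦ (⟨x, X x⟩ : TangentBundle I M))

variable {E' : Type*} [NormedAddCommGroup E'] [NormedSpace ℝ E'] [FiniteDimensional ℝ E']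
  {H' : Type*} [TopologicalSpace H'] {J : ModelWithCorners ℝ E' H'}
  {N : Type*} [TopologicalSpace N] [ChartedSpace H' N] [IsManifold J ∞ N]
  [RiemannianBundle (fun y : N ↦ TangentSpace J y)]
  [IsContMDiffRiemannianBundle J ∞ E' (fun y : N ↦ TangentSpace J y)]

/-- The pullback connection `∇^F` of a connection on `TN`, acting on sections `s` of `F⁻¹TN`:
writing `s = ∑ sⁱ (Eᵢ ∘ F)` in a local frame `Eᵢ` of `TN` around `F p`, one has
`∇^F_u s = ∑ (u(sⁱ) Eᵢ + sⁱ ∇_{F_* u} Eᵢ)`. -/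
def pullbackConnection (cov : CovariantDerivative J E' (fun y : N ↦ TangentSpace J y))
    (F : M → N) (s : Π p : M, TangentSpace J (F p)) (p : M) :
    TangentSpace I p →L[ℝ] TangentSpace J (F p) :=
  letI e := trivializationAt E' (fun y : N ↦ TangentSpace J y) (F p)
  letI b := Module.finBasis ℝ E'
  ∑ i, ((mvfderiv I (fun q ↦ e.localFrameCoeff J b i (F q) (s q)) p).smulRight
      (e.localFrame b i (F p))
    + e.localFrameCoeff J b i (F p) (s p) • (cov (e.localFrame b i) (F p) ∘L mfderiv I J F p))

/-- Along sections of the form `W ∘ F` the pullback connection is `∇^F_u (W ∘ F) = ∇_{F_* u} W`. -/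
theorem pullbackConnection_comp (cov : CovariantDerivative J E' (fun y : N ↦ TangentSpace J y))
    {F : M → N} {p : M} (hF : MDifferentiableAt I J F p) {W : Π y : N, TangentSpace J y}
    (hW : MDiffAt (T% W) (F p)) :
    pullbackConnection (I := I) cov F (fun q ↦ W (F q)) p = cov W (F p) ∘L mfderiv I J F p := by
  set e := trivializationAt E' (fun y : N ↦ TangentSpace J y) (F p) with he
  have hy : F p ∈ e.baseSet := FiberBundle.mem_baseSet_trivializationAt' (F p)
  let b := Module.finBasis ℝ E'
  let c : Fin (Module.finrank ℝ E') → N → ℝ := fun i y ↦ e.localFrameCoeff J b i y (W y)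
  have hc : ∀ i, MDiffAt (c i) (F p) := fun i ↦ mdifferentiableAt_localFrameCoeff b hy hW i
  have hE : ∀ i, MDiffAt (T% (e.localFrame b i)) (F p) := fun i ↦
    (contMDiffAt_localFrame_of_mem 1 e b i hy).mdifferentiableAt one_ne_zero
  have hs : ∀ s : Finset (Fin (Module.finrank ℝ E')),
      MDiffAt (T% (∑ i ∈ s, c i • e.localFrame b i)) (F p) ∧
      cov (∑ i ∈ s, c i • e.localFrame b i) (F p) =
        ∑ i ∈ s, (c i (F p) • cov (e.localFrame b i) (F p)
          + (mvfderiv J (c i) (F p)).smulRight (e.localFrame b i (F p))) := by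
    intro s
    induction s using Finset.induction_on with
    | empty =>
      refine ⟨?_, ?_⟩
      · simpa using! mdifferentiableAt_zeroSection ..
      · simp
    | insert i s hi ih =>
      have h1 := (hc i).smul_section (hE i)
      rw [Finset.sum_insert hi, Finset.sum_insert hi]
      exact ⟨mdifferentiableAt_add_section h1 ih.1, by
        rw [cov.isCovariantDerivativeOnUniv.add h1 ih.1, ih.2,
          cov.isCovariantDerivativeOnUniv.leibniz (hE i) (hc i)]⟩
  have hev : ∀ᶠ y in nhds (F p), W y = (∑ i, c i • e.localFrame b i) y := by
    filter_upwards [e.eventually_eq_localFrame_sum_coeff_smul (I := J) b hy (s := W)] with y h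
    simpa [c] using h
  have hcov : cov W (F p) = ∑ i, (c i (F p) • cov (e.localFrame b i) (F p)
      + (mvfderiv J (c i) (F p)).smulRight (e.localFrame b i (F p))) := by
    rw [← (hs Finset.univ).2]
    exact cov.isCovariantDerivativeOnUniv.congr_of_eventuallyEq hW (hs Finset.univ).1
      Filter.univ_mem hev
  rw [hcov]
  ext u
  simp only [pullbackConnection]
  simp only [ContinuousLinearMap.comp_apply, sum_apply, add_apply,
    ContinuousLinearMap.smulRight_apply, smul_apply]
  refine Finset.sum_congr rfl fun i _ ↦ ?_
  have hd : mvfderiv I (fun q ↦ c i (F q)) p = mvfderiv J (c i) (F p) ∘L mfderiv I J F p :=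
    mvfderiv_comp p (hc i) hF
  change mvfderiv I (fun q ↦ c i (F q)) p u • _ + _ = _
  rw [hd, add_comm]
  rfl

variable (I J) in
/-- The second fundamental form of a map `F : M → N`,
`(∇F_*)(X, Y) = ∇^F_X (F_* Y) - F_* (∇_X Y)`. -/
def secondFundamentalForm (F : M → N) (X Y : Π x : M, TangentSpace I x) (p : M) :
    TangentSpace J (F p) :=
  pullbackConnection (leviCivita J N) F (fun q ↦ mfderiv I J F q (Y q)) p (X p)
    - mfderiv I J F p (leviCivita I M Y p (X p))

variable (I J) in
/-- The vertical space `ker F_*` at `p`. -/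
def verticalSpace (F : M → N) (p : M) : Submodule ℝ (TangentSpace I p) :=
  LinearMap.ker (mfderiv I J F p).toLinearMap

variable (I J) in
/-- The horizontal space `(ker F_*)^⊥` at `p`. -/
def horizontalSpace (F : M → N) (p : M) : Submodule ℝ (TangentSpace I p) :=
  (verticalSpace I J F p)ᗮ

variable (I J) in
/-- The vertical part of a vector field. -/
def ver (F : M → N) (X : Π x : M, TangentSpace I x) (p : M) : TangentSpace I p :=
  (verticalSpace I J F p).starProjection (X p)

variable (I J) in
/-- The horizontal part of a vector field. -/
def hor (F : M → N) (X : Π x : M, TangentSpace I x) (p : M) : TangentSpace I p :=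
  (horizontalSpace I J F p).starProjection (X p)

variable (I J) in
/-- `Γ(ker F_*)`: smooth vertical vector fields. -/
def IsVerticalField (F : M → N) (V : Π x : M, TangentSpace I x) : Prop :=
  IsSmoothField I V ∧ ∀ p, V p ∈ verticalSpace I J F p

variable (I J) in
/-- `Γ((ker F_*)^⊥)`: smooth horizontal vector fields. -/
def IsHorizontalField (F : M → N) (X : Π x : M, TangentSpace I x) : Prop :=
  IsSmoothField I X ∧ ∀ p, X p ∈ horizontalSpace I J F p

variable (I J) in
/-- The horizontal distribution is integrable: it is closed under the Lie bracket. -/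
def HorizontalIntegrable (F : M → N) : Prop :=
  ∀ X Y : Π x : M, TangentSpace I x, IsHorizontalField I J F X → IsHorizontalField I J F Y →
    ∀ p, mlieBracket I X Y p ∈ horizontalSpace I J F p

variable (I J) in
/-- O'Neill's tensor `A_X Y = 𝒱 ∇_{ℋX} (ℋY) + ℋ ∇_{ℋX} (𝒱Y)`. -/
def oneillA (F : M → N) (X Y : Π x : M, TangentSpace I x) : Π x : M, TangentSpace I x :=
  fun p ↦ ver I J F (fun q ↦ leviCivita I M (hor I J F Y) q (hor I J F X q)) p
    + hor I J F (fun q ↦ leviCivita I M (ver I J F Y) q (hor I J F X q)) p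

variable (I J) in
/-- A Riemannian submersion: a smooth map of `M` onto `N`, of maximal rank, whose differential
preserves the lengths of horizontal vectors. -/
structure IsRiemannianSubmersion (F : M → N) : Prop where
  contMDiff : ContMDiff I J ∞ F
  surjective : Function.Surjective F
  surjective_mfderiv : ∀ p, Function.Surjective (mfderiv I J F p)
  norm_mfderiv : ∀ p, ∀ v ∈ horizontalSpace I J F p, ‖mfderiv I J F p v‖ = ‖v‖

variable (I M) in
/-- An almost contact metric structure `(φ, ξ, η, g)` on the Riemannian manifold `(M, g)`. -/
structure AlmostContactMetricStructure where
  /-- the `(1,1)`-tensor field `φ` -/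
  phi : Π p : M, TangentSpace I p →L[ℝ] TangentSpace I p
  /-- the characteristic vector field `ξ` -/
  xi : Π p : M, TangentSpace I p
  /-- the `1`-form `η` -/
  eta : Π p : M, TangentSpace I p →L[ℝ] ℝ
  contMDiff_phi : ContMDiff I (I.prod 𝓘(ℝ, E →L[ℝ] E)) ∞
    (fun p ↦ TotalSpace.mk' (E →L[ℝ] E) (E := fun q : M ↦ TangentSpace I q →L[ℝ] TangentSpace I q)
      p (phi p))
  contMDiff_xi : IsSmoothField I xi
  contMDiff_eta : ContMDiff I (I.prod 𝓘(ℝ, E →L[ℝ] ℝ)) ∞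
    (fun p ↦ TotalSpace.mk' (E →L[ℝ] ℝ)
      (E := fun q : M ↦ TangentSpace I q →L[ℝ] Bundle.Trivial M ℝ q) p (eta p))
  phi_phi : ∀ p v, phi p (phi p v) = -v + eta p v • xi p
  phi_xi : ∀ p, phi p (xi p) = 0
  eta_phi : ∀ p v, eta p (phi p v) = 0
  eta_xi : ∀ p, eta p (xi p) = 1
  inner_phi_phi : ∀ p v w, inner ℝ (phi p v) (phi p w) = inner ℝ v w - eta p v * eta p w
  eta_eq_inner : ∀ p v, eta p v = inner ℝ v (xi p)

variable (I) in
/-- The exterior derivative of a `1`-form `α` on vector fields: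
`X(α(Y)) - Y(α(X)) - α([X, Y])` (under the other usual normalization this is `2 dα(X, Y)`). -/
def extDerivOneForm (α : Π p : M, TangentSpace I p → ℝ) (X Y : Π x : M, TangentSpace I x)
    (p : M) : ℝ :=
  mvfderiv I (fun q ↦ α q (Y q)) p (X p) - mvfderiv I (fun q ↦ α q (X q)) p (Y p)
    - α p (mlieBracket I X Y p)

variable (I) in
/-- The exterior derivative of a `2`-form `α` on vector fields: the cyclic sum of
`X(α(Y, Z)) - α([X, Y], Z)` (under the other usual normalization this is `3 dα(X, Y, Z)`). -/
def extDerivTwoForm (α : Π p : M, TangentSpace I p → TangentSpace I p → ℝ)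
    (X Y Z : Π x : M, TangentSpace I x) (p : M) : ℝ :=
  mvfderiv I (fun q ↦ α q (Y q) (Z q)) p (X p)
    + mvfderiv I (fun q ↦ α q (Z q) (X q)) p (Y p)
    + mvfderiv I (fun q ↦ α q (X q) (Y q)) p (Z p)
    - α p (mlieBracket I X Y p) (Z p)
    - α p (mlieBracket I Y Z p) (X p)
    - α p (mlieBracket I Z X p) (Y p)

variable (I) in
/-- The Nijenhuis tensor `[φ, φ]` of a `(1,1)`-tensor field, on vector fields. -/
def nijenhuis (phi : Π p : M, TangentSpace I p →L[ℝ] TangentSpace I p)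
    (X Y : Π x : M, TangentSpace I x) (p : M) : TangentSpace I p :=
  phi p (phi p (mlieBracket I X Y p))
    + mlieBracket I (fun q ↦ phi q (X q)) (fun q ↦ phi q (Y q)) p
    - phi p (mlieBracket I (fun q ↦ phi q (X q)) Y p)
    - phi p (mlieBracket I X (fun q ↦ phi q (Y q)) p)

namespace AlmostContactMetricStructure

/-- The fundamental `2`-form `Φ(X, Y) = g(X, φY)`. -/
def fundamentalForm (S : AlmostContactMetricStructure I M) (p : M) (v w : TangentSpace I p) : ℝ :=
  inner ℝ v (S.phi p w)

/-- Normality: `[φ, φ] + 2 dη ⊗ ξ = 0`, where `2 dη(X, Y) = X(η(Y)) - Y(η(X)) - η([X, Y])`. -/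
def IsNormal (S : AlmostContactMetricStructure I M) : Prop :=
  ∀ X Y : Π x : M, TangentSpace I x, IsSmoothField I X → IsSmoothField I Y → ∀ p,
    nijenhuis I S.phi X Y p + extDerivOneForm I (fun q v ↦ S.eta q v) X Y p • S.xi p = 0

/-- A cosymplectic structure: a normal almost contact metric structure for which `Φ` and `η` are
closed. -/
structure IsCosymplectic (S : AlmostContactMetricStructure I M) : Prop where
  normal : S.IsNormal
  closed_eta : ∀ X Y : Π x : M, TangentSpace I x, IsSmoothField I X → IsSmoothField I Y →
    ∀ p, extDerivOneForm I (fun q v ↦ S.eta q v) X Y p = 0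
  closed_fundamentalForm : ∀ X Y Z : Π x : M, TangentSpace I x,
    IsSmoothField I X → IsSmoothField I Y → IsSmoothField I Z →
    ∀ p, extDerivTwoForm I S.fundamentalForm X Y Z p = 0

/-- The field `φX`. -/
def phiField (S : AlmostContactMetricStructure I M) (X : Π x : M, TangentSpace I x) :
    Π x : M, TangentSpace I x :=
  fun p ↦ S.phi p (X p)

variable (J) in
/-- `BX`, the vertical component of `φX`. -/
def B (S : AlmostContactMetricStructure I M) (F : M → N) (X : Π x : M, TangentSpace I x) :
    Π x : M, TangentSpace I x :=
  ver I J F (S.phiField X)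

variable (J) in
/-- `CX`, the horizontal component of `φX`. -/
def C (S : AlmostContactMetricStructure I M) (F : M → N) (X : Π x : M, TangentSpace I x) :
    Π x : M, TangentSpace I x :=
  hor I J F (S.phiField X)

variable (J) in
/-- `ker F_*` is anti-invariant: `φ(ker F_*) ⊆ (ker F_*)^⊥`. -/
def IsAntiInvariant (S : AlmostContactMetricStructure I M) (F : M → N) : Prop :=
  ∀ p, ∀ v ∈ verticalSpace I J F p, S.phi p v ∈ horizontalSpace I J F p

variable (J) in
/-- `μ`, the orthogonal complement of `φ(ker F_*)` in `(ker F_*)^⊥`. -/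
def muSpace (S : AlmostContactMetricStructure I M) (F : M → N) (p : M) :
    Submodule ℝ (TangentSpace I p) :=
  horizontalSpace I J F p ⊓ ((verticalSpace I J F p).map (S.phi p).toLinearMap)ᗮ

/-- `φX = BX + CX`. -/
theorem B_add_C (S : AlmostContactMetricStructure I M) (F : M → N)
    (X : Π x : M, TangentSpace I x) (p : M) :
    S.B J F X p + S.C J F X p = S.phi p (X p) := by
  simp [B, C, ver, hor, horizontalSpace, phiField]

/-- If `ξ` is vertical and `ker F_*` is anti-invariant, then `CX` is a section of `μ` for
horizontal `X`, so that `φX = BX + CX` is the decomposition of `φX` along `ker F_* ⊕ μ`. -/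
theorem C_mem_muSpace (S : AlmostContactMetricStructure I M) {F : M → N}
    (hF : S.IsAntiInvariant J F) (hxi : ∀ p, S.xi p ∈ verticalSpace I J F p)
    {X : Π x : M, TangentSpace I x} {p : M} (hX : X p ∈ horizontalSpace I J F p) :
    S.C J F X p ∈ S.muSpace J F p := by
  refine ⟨Submodule.starProjection_apply_mem _ _, ?_⟩
  rintro _ ⟨v, hv, rfl⟩
  have h1 : inner ℝ (S.phi p v) (S.B J F X p) = 0 := by
    rw [real_inner_comm]
    exact hF p v hv _ (Submodule.starProjection_apply_mem _ _)
  have h2 := S.inner_phi_phi p v (X p)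
  have h3 : S.eta p (X p) = 0 := by
    rw [S.eta_eq_inner, real_inner_comm]
    exact hX _ (hxi p)
  rw [← S.B_add_C (J := J) F X p, inner_add_right, h1, h3, hX v hv] at h2
  simp at h2 ⊢
  exact h2

end AlmostContactMetricStructure

end RiemSubm

end

open RiemSubm

/-!
Closedness of `η` makes `∇ξ` symmetric, and closedness of `Φ` together with normality makes the flow
of `ξ` preserve both `Φ` and `φ`, so `∇ξ` is also antisymmetric on the image of `φ`; hence `∇ξ = 0`.
With `∇ξ = 0` the Kähler argument applies: the cyclic sum of `⟪(∇_X φ) Y, Z⟫` vanishes, and `∇φ` is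
read off from the Nijenhuis tensor, giving `∇φ = 0`.

For horizontal `X`, `Y` and vertical `V`, the form `η` vanishes on `[X, Y]`, whence
`⟪[X, Y], V⟫ = ⟪φ[X, Y], φV⟫ = ⟪∇_X (φY) - ∇_Y (φX), φV⟫`. In `φY = BY + CY` the first summand
contributes `⟪A_X BY, φV⟫`, and since `CY` is orthogonal to `φ(ker F_*)` the second one contributes
`-⟪CY, φ A_X V⟫`. As `F_* BY = 0`, the form `(∇F_*)(X, BY)` equals `-F_* (∇_X BY)` and so pairs with
`F_* φV` to `-⟪A_X BY, φV⟫`.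

Integrability may be tested against smooth vertical fields because the horizontal projection of a
smooth field is smooth: its inner products `⟪Y, ℋX⟫ = ⟪F_* Y, F_* X⟫` with smooth fields are.
-/

namespace RiemSubm

section LinearSystem

variable {𝕜 : Type*} [NontriviallyNormedField 𝕜]
  {E : Type*} [NormedAddCommGroup E] [NormedSpace 𝕜 E]
  {H : Type*} [TopologicalSpace H] {I : ModelWithCorners 𝕜 E H}
  {M : Type*} [TopologicalSpace M] [ChartedSpace H M]
  {ι : Type*} [Fintype ι] [DecidableEq ι] {n : ℕ∞ω} {A : M → Matrix ι ι 𝕜} {x : M}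

theorem contMDiffAt_matrix_det (hA : ∀ i j, ContMDiffAt I 𝓘(𝕜) n (fun q ↦ A q i j) x) :
    ContMDiffAt I 𝓘(𝕜) n (fun q ↦ (A q).det) x := by
  simp only [Matrix.det_apply']
  exact contMDiffAt_finsetSum fun σ _ ↦
    contMDiffAt_const.mul (contMDiffAt_finsetProd fun i _ ↦ hA _ _)

theorem contMDiffAt_of_mulVec_eventuallyEq {c w : M → ι → 𝕜}
    (hA : ∀ i j, ContMDiffAt I 𝓘(𝕜) n (fun q ↦ A q i j) x) (hdet : (A x).det ≠ 0)
    (hw : ∀ i, ContMDiffAt I 𝓘(𝕜) n (fun q ↦ w q i) x)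
    (h : ∀ᶠ q in nhds x, (A q).mulVec (c q) = w q) (i : ι) :
    ContMDiffAt I 𝓘(𝕜) n (fun q ↦ c q i) x := by
  have hcol : ContMDiffAt I 𝓘(𝕜) n (fun q ↦ ((A q).updateCol i (w q)).det) x := by
    refine contMDiffAt_matrix_det fun k l ↦ ?_
    by_cases hl : l = i
    · simpa [hl] using hw k
    · simpa [Matrix.updateCol_ne hl] using hA k l
  have hA' := contMDiffAt_matrix_det hA
  refine (hcol.mul (hA'.inv₀ hdet)).congr_of_eventuallyEq ?_
  filter_upwards [h, hA'.continuousAt.eventually_ne hdet] with q hq hdetq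
  have hcramer : (A q).cramer (w q) = (A q).det • c q := by
    rw [← hq, Matrix.cramer_eq_adjugate_mulVec, Matrix.mulVec_mulVec, Matrix.adjugate_mul,
      Matrix.smul_mulVec, Matrix.one_mulVec]
  rw [Pi.mul_apply, eq_mul_inv_iff_mul_eq₀ hdetq, ← Matrix.cramer_apply, hcramer, Pi.smul_apply,
    smul_eq_mul, mul_comm]

end LinearSystem

section RiemannianBundle

variable {E : Type*} [NormedAddCommGroup E] [NormedSpace ℝ E]
  {H : Type*} [TopologicalSpace H] {I : ModelWithCorners ℝ E H}
  {M : Type*} [TopologicalSpace M] [ChartedSpace H M]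
  {F : Type*} [NormedAddCommGroup F] [NormedSpace ℝ F] [FiniteDimensional ℝ F]
  {V : M → Type*} [TopologicalSpace (TotalSpace F V)] [∀ x, NormedAddCommGroup (V x)]
  [∀ x, InnerProductSpace ℝ (V x)] [FiberBundle F V] [VectorBundle ℝ F V] {n : ℕ∞ω}
  [ContMDiffVectorBundle 1 F V I] [ContMDiffVectorBundle n F V I]
  [IsContMDiffRiemannianBundle I n F V]

-- The coefficients in a local frame solve the linear system given by the Gram matrix of the frame.
theorem contMDiffAt_section_of_inner {s : Π x : M, V x} {x : M}
    (h : ∀ t : Π x : M, V x, ContMDiffAt I (I.prod 𝓘(ℝ, F)) n (T% t) x →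
      ContMDiffAt I 𝓘(ℝ) n (fun q ↦ inner ℝ (t q) (s q)) x) :
    ContMDiffAt I (I.prod 𝓘(ℝ, F)) n (T% s) x := by
  let e := trivializationAt F V x
  have hx : x ∈ e.baseSet := FiberBundle.mem_baseSet_trivializationAt' x
  let b := Module.finBasis ℝ F
  have hframe : ∀ i, ContMDiffAt I (I.prod 𝓘(ℝ, F)) n (T% (e.localFrame b i)) x := fun i ↦
    contMDiffAt_localFrame_of_mem n e b i hx
  rw [contMDiffAt_iff_localFrameCoeff (e := e) b hx]
  refine contMDiffAt_of_mulVec_eventuallyEq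
    (A := fun q ↦ Matrix.gram ℝ fun i ↦ e.localFrame b i q)
    (w := fun q i ↦ inner ℝ (e.localFrame b i q) (s q))
    (fun i j ↦ (hframe i).inner_bundle (hframe j)) ?_ (fun i ↦ h _ (hframe i)) ?_
  · exact Matrix.det_gram_ne_zero_iff_linearIndependent.2
      ((e.isLocalFrameOn_localFrame_baseSet I n b).linearIndependent hx)
  · filter_upwards [e.eventually_eq_localFrame_sum_coeff_smul (I := I) b hx (s := s)] with q hq
    ext i
    conv_rhs => rw [hq, inner_sum]
    simp only [Matrix.mulVec, dotProduct, Matrix.gram_apply, real_inner_smul_right, mul_comm,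
      LinearMap.piApply_apply]

end RiemannianBundle

namespace IsSmoothField

variable {E : Type*} [NormedAddCommGroup E] [NormedSpace ℝ E]
  {H : Type*} [TopologicalSpace H] {I : ModelWithCorners ℝ E H}
  {M : Type*} [TopologicalSpace M] [ChartedSpace H M] [IsManifold I ∞ M]
  {X Y : Π x : M, TangentSpace I x}

theorem mdiffAt (hX : IsSmoothField I X) (p : M) : MDiffAt (T% X) p :=
  (hX p).mdifferentiableAt (by simp)

theorem sub (hX : IsSmoothField I X) (hY : IsSmoothField I Y) : IsSmoothField I (X - Y) :=
  ContMDiff.sub_section hX hY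

theorem mlieBracket [CompleteSpace E] (hX : IsSmoothField I X) (hY : IsSmoothField I Y) :
    IsSmoothField I (mlieBracket I X Y) :=
  haveI : IsManifold I (((⊤ : ℕ∞) : ℕ∞ω) + 1) M := inferInstanceAs (IsManifold I ∞ M)
  haveI : IsManifold I (minSmoothness ℝ 2) M := by
    rw [minSmoothness_of_isRCLikeNormedField]; infer_instance
  fun p ↦ ContMDiffAt.mlieBracket_vectorField (n := ⊤) (m := ⊤) (hX p) (hY p) (by simp)

end IsSmoothField

open scoped RealInnerProductSpace

section AlmostContact

variable {E : Type*} [NormedAddCommGroup E] [NormedSpace ℝ E]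
  {H : Type*} [TopologicalSpace H] {I : ModelWithCorners ℝ E H}
  {M : Type*} [TopologicalSpace M] [ChartedSpace H M] [IsManifold I ∞ M]
  [RiemannianBundle (fun x : M ↦ TangentSpace I x)]
  (S : AlmostContactMetricStructure I M) {X : Π x : M, TangentSpace I x} {p : M}

theorem IsSmoothField.phiField (hX : IsSmoothField I X) : IsSmoothField I (S.phiField X) :=
  ContMDiff.clm_bundle_apply (b := fun q : M ↦ q) S.contMDiff_phi hX

namespace AlmostContactMetricStructure

theorem phiField_apply (X : Π x : M, TangentSpace I x) (p : M) :
    S.phiField X p = S.phi p (X p) := rfl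

theorem phiField_xi : S.phiField S.xi = 0 := funext S.phi_xi

theorem inner_xi_phi (v : TangentSpace I p) : ⟪S.xi p, S.phi p v⟫ = 0 := by
  rw [real_inner_comm, ← S.eta_eq_inner, S.eta_phi]

theorem inner_phi_left (v w : TangentSpace I p) : ⟪S.phi p v, w⟫ = -⟪v, S.phi p w⟫ := by
  have h : ⟪S.phi p (S.phi p v), S.phi p w⟫ = ⟪S.phi p v, w⟫ := by
    rw [S.inner_phi_phi, S.eta_phi, zero_mul, sub_zero]
  rw [← h, S.phi_phi, inner_add_left, inner_neg_left, real_inner_smul_left, S.inner_xi_phi,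
    mul_zero, add_zero]

variable {S} {Y : Π x : M, TangentSpace I x}

theorem IsCosymplectic.nijenhuis_eq_zero (hS : S.IsCosymplectic) (hX : IsSmoothField I X)
    (hY : IsSmoothField I Y) (p : M) : nijenhuis I S.phi X Y p = 0 := by
  simpa [hS.closed_eta X Y hX hY p] using hS.normal X Y hX hY p

theorem IsCosymplectic.eta_mlieBracket_eq_zero (hS : S.IsCosymplectic) (hX : IsSmoothField I X)
    (hY : IsSmoothField I Y) {a b : ℝ} (hηX : ∀ q, S.eta q (X q) = a)
    (hηY : ∀ q, S.eta q (Y q) = b) (p : M) : S.eta p (mlieBracket I X Y p) = 0 := by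
  simpa [extDerivOneForm, funext hηX, funext hηY, mvfderiv_const] using hS.closed_eta X Y hX hY p

theorem IsCosymplectic.mlieBracket_phiField_xi (hS : S.IsCosymplectic) (hX : IsSmoothField I X)
    (p : M) : mlieBracket I (S.phiField X) S.xi p = S.phi p (mlieBracket I X S.xi p) := by
  have hη := hS.eta_mlieBracket_eq_zero (hX.phiField S) S.contMDiff_xi
    (fun q ↦ S.eta_phi q (X q)) S.eta_xi p
  have hN : S.phi p (S.phi p (mlieBracket I X S.xi p))
      = S.phi p (mlieBracket I (S.phiField X) S.xi p) := by
    have h := hS.nijenhuis_eq_zero hX S.contMDiff_xi p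
    have hφξ : (fun q ↦ S.phi q (S.xi q)) = 0 := S.phiField_xi
    simp only [nijenhuis, hφξ, mlieBracket_zero_right, Pi.zero_apply, map_zero, add_zero,
      sub_zero] at h
    exact sub_eq_zero.1 h
  have h := congrArg (S.phi p) hN
  rw [S.phi_phi, S.phi_phi, S.eta_phi, hη] at h
  simpa using h.symm

end AlmostContactMetricStructure

end AlmostContact

section Cosymplectic

variable {E : Type*} [NormedAddCommGroup E] [NormedSpace ℝ E] [FiniteDimensional ℝ E]
  {H : Type*} [TopologicalSpace H] {I : ModelWithCorners ℝ E H}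
  {M : Type*} [TopologicalSpace M] [ChartedSpace H M] [IsManifold I ∞ M]
  [RiemannianBundle (fun x : M ↦ TangentSpace I x)]
  [IsContMDiffRiemannianBundle I ∞ E (fun x : M ↦ TangentSpace I x)]
  {X Y Z W : Π x : M, TangentSpace I x} {p : M}

theorem mlieBracket_eq_leviCivita_sub (hX : MDiffAt (T% X) p) (hY : MDiffAt (T% Y) p) :
    mlieBracket I X Y p = leviCivita I M Y p (X p) - leviCivita I M X p (Y p) :=
  ((CovariantDerivative.torsion_eq_zero_iff (leviCivita I M)).1 leviCivita_torsion hX hY).symm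

theorem mvfderiv_inner (hY : MDiffAt (T% Y) p) (hZ : MDiffAt (T% Z) p) (v : TangentSpace I p) :
    mvfderiv I (fun q ↦ ⟪Y q, Z q⟫) p v
      = ⟪leviCivita I M Y p v, Z p⟫ + ⟪Y p, leviCivita I M Z p v⟫ := by
  simpa using leviCivita_metric (FiberBundle.mdifferentiableAt_extend I E v) hY hZ

theorem inner_leviCivita_add_of_inner_eq_const (hY : MDiffAt (T% Y) p) (hZ : MDiffAt (T% Z) p)
    {c : ℝ} (h : ∀ q, ⟪Y q, Z q⟫ = c) (v : TangentSpace I p) :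
    ⟪leviCivita I M Y p v, Z p⟫ + ⟪Y p, leviCivita I M Z p v⟫ = 0 := by
  rw [← mvfderiv_inner hY hZ, funext h, mvfderiv_const, zero_apply]

-- Both sides are the Lie derivative of the metric along `W`, evaluated at `X`, `Z`.
theorem mvfderiv_inner_add_inner_mlieBracket (hX : MDiffAt (T% X) p) (hZ : MDiffAt (T% Z) p)
    (hW : MDiffAt (T% W) p) :
    mvfderiv I (fun q ↦ ⟪X q, Z q⟫) p (W p) + ⟪mlieBracket I X W p, Z p⟫
        + ⟪X p, mlieBracket I Z W p⟫
      = ⟪leviCivita I M W p (X p), Z p⟫ + ⟪X p, leviCivita I M W p (Z p)⟫ := by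
  rw [mvfderiv_inner hX hZ, mlieBracket_eq_leviCivita_sub hX hW,
    mlieBracket_eq_leviCivita_sub hZ hW, inner_sub_left, inner_sub_right]
  ring

namespace AlmostContactMetricStructure

variable (S : AlmostContactMetricStructure I M)

theorem inner_leviCivita_xi_xi (p : M) (v : TangentSpace I p) :
    ⟪leviCivita I M S.xi p v, S.xi p⟫ = 0 := by
  have hξ := S.contMDiff_xi.mdiffAt p
  have hunit : ∀ q, ⟪S.xi q, S.xi q⟫ = 1 := fun q ↦ by rw [← S.eta_eq_inner, S.eta_xi]
  have h := inner_leviCivita_add_of_inner_eq_const hξ hξ hunit v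
  rw [real_inner_comm (leviCivita I M S.xi p v) (S.xi p)] at h
  linarith

variable {S}

theorem IsCosymplectic.inner_leviCivita_xi_symm (hS : S.IsCosymplectic) (hX : IsSmoothField I X)
    (hY : IsSmoothField I Y) (p : M) :
    ⟪leviCivita I M S.xi p (X p), Y p⟫ = ⟪leviCivita I M S.xi p (Y p), X p⟫ := by
  have hξ := S.contMDiff_xi.mdiffAt p
  have h := hS.closed_eta X Y hX hY p
  simp only [extDerivOneForm, S.eta_eq_inner] at h
  rw [mvfderiv_inner (hX.mdiffAt p) hξ, mvfderiv_inner (hY.mdiffAt p) hξ,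
    mlieBracket_eq_leviCivita_sub (hX.mdiffAt p) (hY.mdiffAt p), inner_sub_left] at h
  rw [real_inner_comm (Y p), real_inner_comm (X p)]
  linarith

theorem IsCosymplectic.inner_leviCivita_xi_phi_eq_zero (hS : S.IsCosymplectic)
    (hX : IsSmoothField I X) (hY : IsSmoothField I Y) (p : M) :
    ⟪leviCivita I M S.xi p (X p), S.phi p (Y p)⟫ = 0 := by
  have hφY := hY.phiField S
  have hclosed := hS.closed_fundamentalForm X Y S.xi hX hY S.contMDiff_xi p
  simp only [extDerivTwoForm, fundamentalForm, S.phi_xi, S.inner_xi_phi, inner_zero_right,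
    mvfderiv_const, zero_apply, sub_zero, zero_add] at hclosed
  have hlie := mvfderiv_inner_add_inner_mlieBracket (hX.mdiffAt p) (hφY.mdiffAt p)
    (S.contMDiff_xi.mdiffAt p)
  simp only [hS.mlieBracket_phiField_xi hY, S.phiField_apply] at hlie
  rw [mlieBracket_swap_apply (V := S.xi), inner_neg_left] at hclosed
  have hkilling : ⟪leviCivita I M S.xi p (X p), S.phi p (Y p)⟫
      + ⟪X p, leviCivita I M S.xi p (S.phi p (Y p))⟫ = 0 := by
    have := S.inner_phi_left (mlieBracket I Y S.xi p) (X p)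
    rw [real_inner_comm] at this
    linarith
  have hsymm := hS.inner_leviCivita_xi_symm hX hφY p
  rw [S.phiField_apply, real_inner_comm (X p)] at hsymm
  linarith

theorem IsCosymplectic.inner_leviCivita_xi_eq_zero (hS : S.IsCosymplectic)
    (hX : IsSmoothField I X) (hY : IsSmoothField I Y) (p : M) :
    ⟪leviCivita I M S.xi p (X p), Y p⟫ = 0 := by
  have h := hS.inner_leviCivita_xi_phi_eq_zero hX (hY.phiField S) p
  rwa [S.phiField_apply, S.phi_phi, inner_add_right, real_inner_smul_right,
    S.inner_leviCivita_xi_xi, mul_zero, add_zero, inner_neg_right, neg_eq_zero] at h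

variable (S)

/-- The covariant derivative of `φ`: `S.covPhi Y p v` is `(∇_v φ) Y = ∇_v (φY) - φ (∇_v Y)`. It is
tensorial in `Y`, but is kept as a function of the field, so that no extension of tangent vectors
to vector fields is needed. -/
noncomputable def covPhi (Y : Π x : M, TangentSpace I x) (p : M) :
    TangentSpace I p →L[ℝ] TangentSpace I p :=
  leviCivita I M (S.phiField Y) p - S.phi p ∘L leviCivita I M Y p

theorem covPhi_apply (Y : Π x : M, TangentSpace I x) (p : M) (v : TangentSpace I p) :
    S.covPhi Y p v = leviCivita I M (S.phiField Y) p v - S.phi p (leviCivita I M Y p v) := rfl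

theorem inner_covPhi_swap (hY : IsSmoothField I Y) (hZ : IsSmoothField I Z) (p : M)
    (v : TangentSpace I p) : ⟪S.covPhi Y p v, Z p⟫ = -⟪S.covPhi Z p v, Y p⟫ := by
  have hYZ := mvfderiv_inner ((hY.phiField S).mdiffAt p) (hZ.mdiffAt p) v
  have hZY := mvfderiv_inner (hY.mdiffAt p) ((hZ.phiField S).mdiffAt p) v
  have hskew : (fun q ↦ ⟪S.phiField Y q, Z q⟫) = -fun q ↦ ⟪Y q, S.phiField Z q⟫ :=
    funext fun q ↦ S.inner_phi_left _ _
  rw [hskew, mvfderiv_neg, neg_apply, hZY] at hYZ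
  simp only [S.phiField_apply] at hYZ
  rw [covPhi_apply, covPhi_apply, inner_sub_left, inner_sub_left, S.inner_phi_left,
    S.inner_phi_left, real_inner_comm (Y p), real_inner_comm (S.phi p (Y p))]
  linarith

theorem covPhi_phiField_add (hY : IsSmoothField I Y) (p : M) (v : TangentSpace I p) :
    S.covPhi (S.phiField Y) p v + S.phi p (S.covPhi Y p v)
      = ⟪leviCivita I M S.xi p v, Y p⟫ • S.xi p + S.eta p (Y p) • leviCivita I M S.xi p v := by
  have hcov := (leviCivita I M).isCovariantDerivativeOnUniv
  have hξ := S.contMDiff_xi.mdiffAt p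
  have hη : MDiffAt (fun q ↦ ⟪Y q, S.xi q⟫) p := mdiff_inner (hY.mdiffAt p) hξ
  have hc : MDiffAt (fun _ : M ↦ (-1 : ℝ)) p := mdifferentiableAt_const
  have hφφ : S.phiField (S.phiField Y)
      = (fun _ : M ↦ (-1 : ℝ)) • Y + (fun q ↦ ⟪Y q, S.xi q⟫) • S.xi := by
    funext q
    simp [phiField, S.phi_phi, S.eta_eq_inner]
  have hderiv : leviCivita I M (S.phiField (S.phiField Y)) p v
      = -leviCivita I M Y p v + ⟪Y p, S.xi p⟫ • leviCivita I M S.xi p v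
        + (⟪leviCivita I M Y p v, S.xi p⟫ + ⟪Y p, leviCivita I M S.xi p v⟫) • S.xi p := by
    rw [hφφ, hcov.add (hc.smul_section (hY.mdiffAt p)) (hη.smul_section hξ),
      hcov.leibniz (hY.mdiffAt p) hc, hcov.leibniz hξ hη, ← mvfderiv_inner (hY.mdiffAt p) hξ]
    simp [mvfderiv_const, add_assoc]
  rw [covPhi_apply, covPhi_apply, map_sub, S.phi_phi, hderiv, S.eta_eq_inner, S.eta_eq_inner,
    real_inner_comm (Y p), add_smul]
  abel

theorem nijenhuis_eq_covPhi (hX : IsSmoothField I X) (hY : IsSmoothField I Y) (p : M) :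
    nijenhuis I S.phi X Y p = S.covPhi Y p (S.phi p (X p)) - S.covPhi X p (S.phi p (Y p))
      + S.phi p (S.covPhi X p (Y p)) - S.phi p (S.covPhi Y p (X p)) := by
  have hφX := (hX.phiField S).mdiffAt p
  have hφY := (hY.phiField S).mdiffAt p
  change S.phi p (S.phi p (mlieBracket I X Y p))
    + mlieBracket I (S.phiField X) (S.phiField Y) p
    - S.phi p (mlieBracket I (S.phiField X) Y p)
    - S.phi p (mlieBracket I X (S.phiField Y) p) = _
  rw [mlieBracket_eq_leviCivita_sub (hX.mdiffAt p) (hY.mdiffAt p),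
    mlieBracket_eq_leviCivita_sub hφX hφY, mlieBracket_eq_leviCivita_sub hφX (hY.mdiffAt p),
    mlieBracket_eq_leviCivita_sub (hX.mdiffAt p) hφY]
  simp only [covPhi_apply, map_sub, S.phiField_apply]
  abel

theorem extDerivTwoForm_fundamentalForm_eq_covPhi (hX : IsSmoothField I X)
    (hY : IsSmoothField I Y) (hZ : IsSmoothField I Z) (p : M) :
    extDerivTwoForm I S.fundamentalForm X Y Z p = -(⟪S.covPhi Y p (X p), Z p⟫
      + ⟪S.covPhi Z p (Y p), X p⟫ + ⟪S.covPhi X p (Z p), Y p⟫) := by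
  have hderiv : ∀ {Y Z : Π x : M, TangentSpace I x}, IsSmoothField I Y → IsSmoothField I Z →
      ∀ v : TangentSpace I p, mvfderiv I (fun q ↦ ⟪Y q, S.phi q (Z q)⟫) p v
        = ⟪leviCivita I M Y p v, S.phi p (Z p)⟫ - ⟪leviCivita I M Z p v, S.phi p (Y p)⟫
          - ⟪S.covPhi Y p v, Z p⟫ := by
    intro Y Z hY hZ v
    have h := mvfderiv_inner (hY.mdiffAt p) ((hZ.phiField S).mdiffAt p) v
    simp only [S.phiField_apply] at h
    rw [h, S.inner_covPhi_swap hY hZ, covPhi_apply, inner_sub_left, S.inner_phi_left,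
      real_inner_comm (Y p)]
    ring
  simp only [extDerivTwoForm, fundamentalForm]
  rw [hderiv hY hZ, hderiv hZ hX, hderiv hX hY,
    mlieBracket_eq_leviCivita_sub (hX.mdiffAt p) (hY.mdiffAt p),
    mlieBracket_eq_leviCivita_sub (hY.mdiffAt p) (hZ.mdiffAt p),
    mlieBracket_eq_leviCivita_sub (hZ.mdiffAt p) (hX.mdiffAt p),
    inner_sub_left, inner_sub_left, inner_sub_left]
  ring

namespace IsCosymplectic

variable {S}

theorem inner_covPhi_cyclic (hS : S.IsCosymplectic) (hX : IsSmoothField I X)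
    (hY : IsSmoothField I Y) (hZ : IsSmoothField I Z) (p : M) :
    ⟪S.covPhi Y p (X p), Z p⟫ + ⟪S.covPhi Z p (Y p), X p⟫ + ⟪S.covPhi X p (Z p), Y p⟫ = 0 := by
  rw [← neg_eq_zero, ← S.extDerivTwoForm_fundamentalForm_eq_covPhi hX hY hZ,
    hS.closed_fundamentalForm X Y Z hX hY hZ]

theorem inner_covPhi_phiField (hS : S.IsCosymplectic) (hX : IsSmoothField I X)
    (hY : IsSmoothField I Y) (hZ : IsSmoothField I Z) (p : M) :
    ⟪S.covPhi (S.phiField Y) p (X p), Z p⟫ = ⟪S.covPhi Y p (X p), S.phi p (Z p)⟫ := by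
  have h := congrArg (⟪·, Z p⟫) (S.covPhi_phiField_add hY p (X p))
  simp only [inner_add_left, real_inner_smul_left, hS.inner_leviCivita_xi_eq_zero hX hY,
    hS.inner_leviCivita_xi_eq_zero hX hZ, zero_mul, mul_zero, S.inner_phi_left] at h
  linarith

theorem inner_covPhi_xi (hS : S.IsCosymplectic) (hX : IsSmoothField I X)
    (hY : IsSmoothField I Y) (p : M) : ⟪S.covPhi Y p (X p), S.xi p⟫ = 0 := by
  rw [S.inner_covPhi_swap hY S.contMDiff_xi, covPhi_apply, S.phiField_xi, CovariantDerivative.zero,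
    Pi.zero_apply, zero_apply, zero_sub, inner_neg_left, S.inner_phi_left,
    hS.inner_leviCivita_xi_phi_eq_zero hX hY, neg_zero, neg_zero, neg_zero]

theorem inner_covPhi_phi_phi (hS : S.IsCosymplectic) (hX : IsSmoothField I X)
    (hY : IsSmoothField I Y) (p : M) (w : TangentSpace I p) :
    ⟪S.covPhi Y p (X p), S.phi p (S.phi p w)⟫ = -⟪S.covPhi Y p (X p), w⟫ := by
  rw [S.phi_phi, inner_add_right, inner_neg_right, real_inner_smul_right,
    hS.inner_covPhi_xi hX hY, mul_zero, add_zero]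

theorem inner_covPhi_phi_sub (hS : S.IsCosymplectic) (hX : IsSmoothField I X)
    (hY : IsSmoothField I Y) (p : M) (w : TangentSpace I p) :
    ⟪S.covPhi Y p (S.phi p (X p)), w⟫ - ⟪S.covPhi X p (S.phi p (Y p)), w⟫
      = ⟪S.covPhi X p (Y p), S.phi p w⟫ - ⟪S.covPhi Y p (X p), S.phi p w⟫ := by
  have h := congrArg (⟪·, w⟫)
    ((S.nijenhuis_eq_covPhi hX hY p).symm.trans (hS.nijenhuis_eq_zero hX hY p))
  simp only [inner_sub_left, inner_add_left, S.inner_phi_left, inner_zero_left] at h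
  linarith

-- As for Kähler manifolds: the cyclic identity for `(X, φY, φZ)` is compared with the one for
-- `(X, Y, Z)` by means of the vanishing Nijenhuis tensor.
theorem inner_covPhi_eq_zero (hS : S.IsCosymplectic) (hX : IsSmoothField I X)
    (hY : IsSmoothField I Y) (hZ : IsSmoothField I Z) (p : M) :
    ⟪S.covPhi Y p (X p), Z p⟫ = 0 := by
  have hφX := hX.phiField S
  have hφY := hY.phiField S
  have hφZ := hZ.phiField S
  have hclosed := hS.inner_covPhi_cyclic hX hφY hφZ p
  have hXYZ : ⟪S.covPhi (S.phiField Y) p (X p), S.phiField Z p⟫ = -⟪S.covPhi Y p (X p), Z p⟫ := by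
    rw [hS.inner_covPhi_phiField hX hY hφZ, S.phiField_apply, hS.inner_covPhi_phi_phi hX hY]
  have hYZX := hS.inner_covPhi_phiField hφY hZ hX p
  have hZXY : ⟪S.covPhi X p (S.phiField Z p), S.phiField Y p⟫
      = -⟪S.covPhi Y p (S.phiField Z p), S.phi p (X p)⟫ := by
    rw [S.phiField_apply Y, ← hS.inner_covPhi_phiField hφZ hX hY, S.inner_covPhi_swap hφX hY,
      S.phiField_apply X]
  have hnormal := hS.inner_covPhi_phi_sub hY hZ p (S.phi p (X p))
  rw [hS.inner_covPhi_phi_phi hZ hY, hS.inner_covPhi_phi_phi hY hZ] at hnormal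
  rw [hXYZ, hYZX, hZXY, S.phiField_apply, S.phiField_apply] at hclosed
  linarith [hS.inner_covPhi_cyclic hX hY hZ p, S.inner_covPhi_swap hX hY p (Z p)]

theorem inner_leviCivita_phiField (hS : S.IsCosymplectic) (hX : IsSmoothField I X)
    (hY : IsSmoothField I Y) (hZ : IsSmoothField I Z) (p : M) :
    ⟪leviCivita I M (S.phiField Y) p (X p), Z p⟫ = ⟪S.phi p (leviCivita I M Y p (X p)), Z p⟫ := by
  rw [← sub_eq_zero, ← inner_sub_left, ← covPhi_apply, hS.inner_covPhi_eq_zero hX hY hZ]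

end IsCosymplectic

end AlmostContactMetricStructure

end Cosymplectic

section Projections

variable {E : Type*} [NormedAddCommGroup E] [NormedSpace ℝ E]
  {H : Type*} [TopologicalSpace H] {I : ModelWithCorners ℝ E H}
  {M : Type*} [TopologicalSpace M] [ChartedSpace H M]
  {E' : Type*} [NormedAddCommGroup E'] [NormedSpace ℝ E']
  {H' : Type*} [TopologicalSpace H'] {J : ModelWithCorners ℝ E' H'}
  {N : Type*} [TopologicalSpace N] [ChartedSpace H' N]
  {F : M → N} {X : Π x : M, TangentSpace I x} {p : M} {v w : TangentSpace I p}

theorem mfderiv_of_mem_verticalSpace (hv : v ∈ verticalSpace I J F p) :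
    mfderiv I J F p v = 0 := hv

variable [RiemannianBundle (fun x : M ↦ TangentSpace I x)]

theorem inner_eq_zero_of_vertical_of_horizontal (hv : v ∈ verticalSpace I J F p)
    (hw : w ∈ horizontalSpace I J F p) : ⟪v, w⟫ = 0 := hw v hv

variable [FiniteDimensional ℝ E]

theorem ver_mem (F : M → N) (X : Π x : M, TangentSpace I x) (p : M) :
    ver I J F X p ∈ verticalSpace I J F p :=
  Submodule.starProjection_apply_mem _ _

theorem hor_mem (F : M → N) (X : Π x : M, TangentSpace I x) (p : M) :
    hor I J F X p ∈ horizontalSpace I J F p :=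
  Submodule.starProjection_apply_mem _ _

theorem ver_add_hor (F : M → N) (X : Π x : M, TangentSpace I x) (p : M) :
    ver I J F X p + hor I J F X p = X p :=
  Submodule.starProjection_add_starProjection_orthogonal _

theorem ver_eq_self (h : X p ∈ verticalSpace I J F p) : ver I J F X p = X p :=
  Submodule.starProjection_eq_self_iff.2 h

theorem hor_eq_self (h : X p ∈ horizontalSpace I J F p) : hor I J F X p = X p :=
  Submodule.starProjection_eq_self_iff.2 h

theorem hor_eq_zero (h : X p ∈ verticalSpace I J F p) : hor I J F X p = 0 := by
  simpa [ver_eq_self h] using ver_add_hor (J := J) F X p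

theorem mfderiv_hor (F : M → N) (X : Π x : M, TangentSpace I x) (p : M) :
    mfderiv I J F p (hor I J F X p) = mfderiv I J F p (X p) := by
  conv_rhs => rw [← ver_add_hor (J := J) F X p, map_add,
    mfderiv_of_mem_verticalSpace (ver_mem F X p), zero_add]

theorem inner_hor_left (X : Π x : M, TangentSpace I x) (hw : w ∈ horizontalSpace I J F p) :
    ⟪hor I J F X p, w⟫ = ⟪X p, w⟫ := by
  conv_rhs => rw [← ver_add_hor (J := J) F X p, inner_add_left,
    inner_eq_zero_of_vertical_of_horizontal (ver_mem F X p) hw, zero_add]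

theorem mem_horizontalSpace_of_inner_ver_eq_zero (h : ⟪X p, ver I J F X p⟫ = 0) :
    X p ∈ horizontalSpace I J F p := by
  have hver : ver I J F X p = 0 := by
    rwa [← ver_add_hor (J := J) F X p, inner_add_left, real_inner_comm _ (hor I J F X p),
      inner_eq_zero_of_vertical_of_horizontal (ver_mem F X p) (hor_mem F X p), add_zero,
      inner_self_eq_zero] at h
  rw [← ver_add_hor (J := J) F X p, hver, zero_add]
  exact hor_mem F X p

end Projections

section RiemannianMap

variable {E : Type*} [NormedAddCommGroup E] [NormedSpace ℝ E]
  {H : Type*} [TopologicalSpace H] {I : ModelWithCorners ℝ E H}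
  {M : Type*} [TopologicalSpace M] [ChartedSpace H M]
  [RiemannianBundle (fun x : M ↦ TangentSpace I x)]
  {E' : Type*} [NormedAddCommGroup E'] [NormedSpace ℝ E']
  {H' : Type*} [TopologicalSpace H'] {J : ModelWithCorners ℝ E' H'}
  {N : Type*} [TopologicalSpace N] [ChartedSpace H' N]
  [RiemannianBundle (fun y : N ↦ TangentSpace J y)]
  {F : M → N} {X : Π x : M, TangentSpace I x} {p : M} {w : TangentSpace I p}

variable (I J) in
/-- A Riemannian map in the sense of Fischer: a smooth map whose differential is isometric on
horizontal vectors. Riemannian submersions and isometric immersions are the extreme cases. -/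
structure IsRiemannianMap (F : M → N) : Prop where
  contMDiff : ContMDiff I J ∞ F
  norm_mfderiv : ∀ p, ∀ v ∈ horizontalSpace I J F p, ‖mfderiv I J F p v‖ = ‖v‖

theorem IsRiemannianSubmersion.isRiemannianMap (hF : IsRiemannianSubmersion I J F) :
    IsRiemannianMap I J F :=
  ⟨hF.contMDiff, hF.norm_mfderiv⟩

namespace IsRiemannianMap

theorem inner_mfderiv (hF : IsRiemannianMap I J F) {v : TangentSpace I p}
    (hv : v ∈ horizontalSpace I J F p) (hw : w ∈ horizontalSpace I J F p) :
    ⟪mfderiv I J F p v, mfderiv I J F p w⟫ = ⟪v, w⟫ := by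
  rw [real_inner_eq_norm_add_mul_self_sub_norm_mul_self_sub_norm_mul_self_div_two,
    real_inner_eq_norm_add_mul_self_sub_norm_mul_self_sub_norm_mul_self_div_two, ← map_add,
    hF.norm_mfderiv p _ hv, hF.norm_mfderiv p _ hw,
    hF.norm_mfderiv p _ (Submodule.add_mem _ hv hw)]

variable [FiniteDimensional ℝ E]

theorem inner_mfderiv_left (hF : IsRiemannianMap I J F) (v : TangentSpace I p)
    (hw : w ∈ horizontalSpace I J F p) :
    ⟪mfderiv I J F p v, mfderiv I J F p w⟫ = ⟪v, w⟫ := by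
  obtain ⟨u, hu, h, hh, rfl⟩ := (verticalSpace I J F p).exists_add_mem_mem_orthogonal v
  rw [map_add, mfderiv_of_mem_verticalSpace hu, zero_add, hF.inner_mfderiv hh hw, inner_add_left,
    inner_eq_zero_of_vertical_of_horizontal hu hw, zero_add]

variable [IsManifold I ∞ M] [IsContMDiffRiemannianBundle I ∞ E (fun x : M ↦ TangentSpace I x)]
  [IsManifold J ∞ N] [IsContMDiffRiemannianBundle J ∞ E' (fun y : N ↦ TangentSpace J y)]

theorem isSmoothField_hor (hF : IsRiemannianMap I J F) (hX : IsSmoothField I X) :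
    IsSmoothField I (hor I J F X) := by
  intro p
  refine contMDiffAt_section_of_inner (V := fun x : M ↦ TangentSpace I x) fun Y hY ↦ ?_
  have hT : ContMDiff I.tangent J.tangent ∞ (tangentMap I J F) :=
    hF.contMDiff.contMDiff_tangentMap (by simp)
  have hFY : ContMDiffAt I J.tangent ∞
      (fun q ↦ (⟨F q, mfderiv I J F q (Y q)⟩ : TangentBundle J N)) p :=
    (hT _).comp p hY
  have hFX : ContMDiffAt I J.tangent ∞
      (fun q ↦ (⟨F q, mfderiv I J F q (X q)⟩ : TangentBundle J N)) p :=
    (hT _).comp p (hX p)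
  have hinner : (fun q ↦ ⟪Y q, hor I J F X q⟫)
      = fun q ↦ ⟪mfderiv I J F q (Y q), mfderiv I J F q (X q)⟫ := by
    funext q
    rw [← hF.inner_mfderiv_left (Y q) (hor_mem F X q), mfderiv_hor]
  rw [hinner]
  exact ContMDiffAt.inner_bundle (F := E') (E := fun y : N ↦ TangentSpace J y) (b := F) hFY hFX

theorem isSmoothField_ver (hF : IsRiemannianMap I J F) (hX : IsSmoothField I X) :
    IsSmoothField I (ver I J F X) := by
  have hver : ver I J F X = X - hor I J F X :=
    eq_sub_of_add_eq (funext (ver_add_hor F X))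
  rw [hver]
  exact hX.sub (hF.isSmoothField_hor hX)

theorem horizontalIntegrable_iff (hF : IsRiemannianMap I J F) :
    HorizontalIntegrable I J F ↔ ∀ X Y V : Π x : M, TangentSpace I x,
      IsHorizontalField I J F X → IsHorizontalField I J F Y → IsVerticalField I J F V →
      ∀ p, ⟪mlieBracket I X Y p, V p⟫ = 0 := by
  refine ⟨fun h X Y V hX hY hV p ↦ ?_, fun h X Y hX hY p ↦ ?_⟩
  · rw [real_inner_comm]
    exact inner_eq_zero_of_vertical_of_horizontal (hV.2 p) (h X Y hX hY p)
  · exact mem_horizontalSpace_of_inner_ver_eq_zero (h X Y _ hX hY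
      ⟨hF.isSmoothField_ver (hX.1.mlieBracket hY.1), ver_mem F _⟩ p)

end IsRiemannianMap

end RiemannianMap

section ONeill

variable {E : Type*} [NormedAddCommGroup E] [NormedSpace ℝ E] [FiniteDimensional ℝ E]
  {H : Type*} [TopologicalSpace H] {I : ModelWithCorners ℝ E H}
  {M : Type*} [TopologicalSpace M] [ChartedSpace H M] [IsManifold I ∞ M]
  [RiemannianBundle (fun x : M ↦ TangentSpace I x)]
  [IsContMDiffRiemannianBundle I ∞ E (fun x : M ↦ TangentSpace I x)]
  {E' : Type*} [NormedAddCommGroup E'] [NormedSpace ℝ E']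
  {H' : Type*} [TopologicalSpace H'] {J : ModelWithCorners ℝ E' H'}
  {N : Type*} [TopologicalSpace N] [ChartedSpace H' N]
  {F : M → N} {X Y V : Π x : M, TangentSpace I x} {p : M} {w : TangentSpace I p}

theorem oneillA_of_horizontal_of_vertical (hX : ∀ q, X q ∈ horizontalSpace I J F q)
    (hV : ∀ q, V q ∈ verticalSpace I J F q) (p : M) :
    oneillA I J F X V p = hor I J F (fun q ↦ leviCivita I M V q (X q)) p := by
  have hhorV : hor I J F V = 0 := funext fun q ↦ hor_eq_zero (hV q)
  have hverV : ver I J F V = V := funext fun q ↦ ver_eq_self (hV q)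
  have hhorX : hor I J F X = X := funext fun q ↦ hor_eq_self (hX q)
  have hzero : ver I J F (fun q ↦ (0 : TangentSpace I q)) p = 0 := map_zero _
  rw [oneillA, hhorV, hverV, hhorX]
  simp only [CovariantDerivative.zero, Pi.zero_apply, zero_apply, hzero, zero_add]

theorem inner_oneillA_of_horizontal_of_vertical (hX : ∀ q, X q ∈ horizontalSpace I J F q)
    (hV : ∀ q, V q ∈ verticalSpace I J F q) (hw : w ∈ horizontalSpace I J F p) :
    ⟪oneillA I J F X V p, w⟫ = ⟪leviCivita I M V p (X p), w⟫ := by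
  rw [oneillA_of_horizontal_of_vertical hX hV, inner_hor_left _ hw]

variable [FiniteDimensional ℝ E'] [IsManifold J ∞ N]
  [RiemannianBundle (fun y : N ↦ TangentSpace J y)]
  [IsContMDiffRiemannianBundle J ∞ E' (fun y : N ↦ TangentSpace J y)]

theorem secondFundamentalForm_of_vertical (Y : Π x : M, TangentSpace I x)
    (hV : ∀ q, V q ∈ verticalSpace I J F q) (p : M) :
    secondFundamentalForm I J F Y V p = -mfderiv I J F p (leviCivita I M V p (Y p)) := by
  have hFV : (fun q ↦ mfderiv I J F q (V q)) = fun _ ↦ 0 :=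
    funext fun q ↦ mfderiv_of_mem_verticalSpace (hV q)
  rw [secondFundamentalForm, hFV]
  simp [pullbackConnection, mvfderiv_const]

theorem IsRiemannianMap.inner_secondFundamentalForm (hF : IsRiemannianMap I J F)
    (hY : ∀ q, Y q ∈ horizontalSpace I J F q) (hV : ∀ q, V q ∈ verticalSpace I J F q)
    (hw : w ∈ horizontalSpace I J F p) :
    ⟪secondFundamentalForm I J F Y V p, mfderiv I J F p w⟫ = -⟪oneillA I J F Y V p, w⟫ := by
  rw [secondFundamentalForm_of_vertical Y hV, inner_neg_left, hF.inner_mfderiv_left _ hw,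
    inner_oneillA_of_horizontal_of_vertical hY hV hw]

end ONeill

namespace AlmostContactMetricStructure

variable {E : Type*} [NormedAddCommGroup E] [NormedSpace ℝ E]
  {H : Type*} [TopologicalSpace H] {I : ModelWithCorners ℝ E H}
  {M : Type*} [TopologicalSpace M] [ChartedSpace H M] [IsManifold I ∞ M]
  [RiemannianBundle (fun x : M ↦ TangentSpace I x)]
  {E' : Type*} [NormedAddCommGroup E'] [NormedSpace ℝ E']
  {H' : Type*} [TopologicalSpace H'] {J : ModelWithCorners ℝ E' H'}
  {N : Type*} [TopologicalSpace N] [ChartedSpace H' N]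
  (S : AlmostContactMetricStructure I M) {F : M → N} {X Y V : Π x : M, TangentSpace I x} {p : M}
  {v : TangentSpace I p}

theorem B_mem [FiniteDimensional ℝ E] (F : M → N) (X : Π x : M, TangentSpace I x) (p : M) :
    S.B J F X p ∈ verticalSpace I J F p := ver_mem F _ p

theorem eta_of_horizontal (hxi : ∀ p, S.xi p ∈ verticalSpace I J F p)
    (hv : v ∈ horizontalSpace I J F p) : S.eta p v = 0 := by
  rw [S.eta_eq_inner, real_inner_comm]
  exact inner_eq_zero_of_vertical_of_horizontal (hxi p) hv

variable [FiniteDimensional ℝ E] [IsContMDiffRiemannianBundle I ∞ E (fun x : M ↦ TangentSpace I x)]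
  [FiniteDimensional ℝ E'] [IsManifold J ∞ N] [RiemannianBundle (fun y : N ↦ TangentSpace J y)]
  [IsContMDiffRiemannianBundle J ∞ E' (fun y : N ↦ TangentSpace J y)]

theorem inner_C_phi (hanti : S.IsAntiInvariant J F) (hxi : ∀ p, S.xi p ∈ verticalSpace I J F p)
    (hX : X p ∈ horizontalSpace I J F p) (hv : v ∈ verticalSpace I J F p) :
    ⟪S.C J F X p, S.phi p v⟫ = 0 := by
  rw [real_inner_comm]
  exact (S.C_mem_muSpace hanti hxi hX).2 _ ⟨v, hv, rfl⟩

theorem inner_C_phi_oneillA (hanti : S.IsAntiInvariant J F)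
    (hxi : ∀ p, S.xi p ∈ verticalSpace I J F p) (hX : ∀ q, X q ∈ horizontalSpace I J F q)
    (hY : Y p ∈ horizontalSpace I J F p) (hV : ∀ q, V q ∈ verticalSpace I J F q) :
    ⟪S.C J F Y p, S.phi p (oneillA I J F X V p)⟫
      = ⟪S.C J F Y p, S.phi p (leviCivita I M V p (X p))⟫ := by
  rw [oneillA_of_horizontal_of_vertical hX hV,
    ← ver_add_hor (J := J) F (fun q ↦ leviCivita I M V q (X q)) p, map_add, inner_add_right,
    S.inner_C_phi hanti hxi hY (ver_mem F _ p), zero_add]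

namespace IsCosymplectic

variable {S}

theorem inner_phi_leviCivita_phi (hS : S.IsCosymplectic) (hF : IsRiemannianMap I J F)
    (hanti : S.IsAntiInvariant J F) (hxi : ∀ p, S.xi p ∈ verticalSpace I J F p)
    (hX : IsHorizontalField I J F X) (hY : IsHorizontalField I J F Y)
    (hV : IsVerticalField I J F V) (p : M) :
    ⟪S.phi p (leviCivita I M Y p (X p)), S.phi p (V p)⟫
      = ⟪oneillA I J F X (S.B J F Y) p, S.phi p (V p)⟫
        - ⟪S.C J F Y p, S.phi p (oneillA I J F X V p)⟫ := by
  have hB : IsSmoothField I (S.B J F Y) := hF.isSmoothField_ver (hY.1.phiField S)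
  have hC : IsSmoothField I (S.C J F Y) := hF.isSmoothField_hor (hY.1.phiField S)
  have hφV := hV.1.phiField S
  have hφY : S.phiField Y = S.B J F Y + S.C J F Y :=
    funext fun q ↦ (S.B_add_C (J := J) F Y q).symm
  have hC_phi : ⟪leviCivita I M (S.C J F Y) p (X p), S.phi p (V p)⟫
      = -⟪S.C J F Y p, leviCivita I M (S.phiField V) p (X p)⟫ :=
    eq_neg_of_add_eq_zero_left <| inner_leviCivita_add_of_inner_eq_const (hC.mdiffAt p)
      (hφV.mdiffAt p) (fun q ↦ S.inner_C_phi hanti hxi (hY.2 q) (hV.2 q)) (X p)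
  have hC_oneillA : ⟪S.C J F Y p, leviCivita I M (S.phiField V) p (X p)⟫
      = ⟪S.C J F Y p, S.phi p (oneillA I J F X V p)⟫ := by
    rw [S.inner_C_phi_oneillA hanti hxi hX.2 (hY.2 p) hV.2, real_inner_comm,
      hS.inner_leviCivita_phiField hX.1 hV.1 hC, real_inner_comm]
  calc ⟪S.phi p (leviCivita I M Y p (X p)), S.phi p (V p)⟫
    _ = ⟪leviCivita I M (S.phiField Y) p (X p), S.phi p (V p)⟫ :=
      (hS.inner_leviCivita_phiField hX.1 hY.1 hφV p).symm
    _ = ⟪leviCivita I M (S.B J F Y) p (X p), S.phi p (V p)⟫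
        + ⟪leviCivita I M (S.C J F Y) p (X p), S.phi p (V p)⟫ := by
      rw [hφY, (leviCivita I M).isCovariantDerivativeOnUniv.add (hB.mdiffAt p) (hC.mdiffAt p),
        add_apply, inner_add_left]
    _ = ⟪oneillA I J F X (S.B J F Y) p, S.phi p (V p)⟫
        - ⟪S.C J F Y p, S.phi p (oneillA I J F X V p)⟫ := by
      rw [hC_phi, hC_oneillA, ← sub_eq_add_neg, inner_oneillA_of_horizontal_of_vertical hX.2
        (S.B_mem F Y) (hanti p _ (hV.2 p))]

theorem inner_mlieBracket (hS : S.IsCosymplectic) (hF : IsRiemannianMap I J F)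
    (hanti : S.IsAntiInvariant J F) (hxi : ∀ p, S.xi p ∈ verticalSpace I J F p)
    (hX : IsHorizontalField I J F X) (hY : IsHorizontalField I J F Y)
    (hV : IsVerticalField I J F V) (p : M) :
    ⟪mlieBracket I X Y p, V p⟫
      = ⟪oneillA I J F X (S.B J F Y) p - oneillA I J F Y (S.B J F X) p, S.phi p (V p)⟫
        - (⟪S.C J F Y p, S.phi p (oneillA I J F X V p)⟫
          - ⟪S.C J F X p, S.phi p (oneillA I J F Y V p)⟫) := by
  have hη : S.eta p (mlieBracket I X Y p) = 0 :=
    hS.eta_mlieBracket_eq_zero hX.1 hY.1 (fun q ↦ S.eta_of_horizontal hxi (hX.2 q))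
      (fun q ↦ S.eta_of_horizontal hxi (hY.2 q)) p
  have hφ : ⟪S.phi p (mlieBracket I X Y p), S.phi p (V p)⟫ = ⟪mlieBracket I X Y p, V p⟫ := by
    rw [S.inner_phi_phi, hη, zero_mul, sub_zero]
  rw [← hφ, mlieBracket_eq_leviCivita_sub (hX.1.mdiffAt p) (hY.1.mdiffAt p), map_sub,
    inner_sub_left, inner_sub_left, hS.inner_phi_leviCivita_phi hF hanti hxi hX hY hV,
    hS.inner_phi_leviCivita_phi hF hanti hxi hY hX hV]
  ring

end IsCosymplectic

end AlmostContactMetricStructure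

end RiemSubm

theorem theorem3_general
    {E : Type*} [NormedAddCommGroup E] [NormedSpace ℝ E] [FiniteDimensional ℝ E]
    {H : Type*} [TopologicalSpace H] {I : ModelWithCorners ℝ E H}
    {M : Type*} [TopologicalSpace M] [ChartedSpace H M] [IsManifold I ∞ M]
    [RiemannianBundle (fun x : M ↦ TangentSpace I x)]
    [IsContMDiffRiemannianBundle I ∞ E (fun x : M ↦ TangentSpace I x)]
    {E' : Type*} [NormedAddCommGroup E'] [NormedSpace ℝ E'] [FiniteDimensional ℝ E']
    {H' : Type*} [TopologicalSpace H'] {J : ModelWithCorners ℝ E' H'}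
    {N : Type*} [TopologicalSpace N] [ChartedSpace H' N] [IsManifold J ∞ N]
    [RiemannianBundle (fun y : N ↦ TangentSpace J y)]
    [IsContMDiffRiemannianBundle J ∞ E' (fun y : N ↦ TangentSpace J y)]
    (S : AlmostContactMetricStructure I M) (hS : S.IsCosymplectic)
    (F : M → N) (hF : IsRiemannianMap I J F) (hanti : S.IsAntiInvariant J F)
    (hxi : ∀ p, S.xi p ∈ verticalSpace I J F p) :
    List.TFAE [
      HorizontalIntegrable I J F,
      ∀ X Y V : Π x : M, TangentSpace I x,
        IsHorizontalField I J F X → IsHorizontalField I J F Y →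
        IsVerticalField I J F V → ∀ p : M,
        inner ℝ (secondFundamentalForm I J F Y (S.B J F X) p)
            (mfderiv I J F p (S.phi p (V p)))
          = inner ℝ (secondFundamentalForm I J F X (S.B J F Y) p)
              (mfderiv I J F p (S.phi p (V p)))
            + inner ℝ (S.C J F Y p)
                (S.phi p (oneillA I J F X V p))
            - inner ℝ (S.C J F X p)
                (S.phi p (oneillA I J F Y V p)),
      ∀ X Y V : Π x : M, TangentSpace I x,
        IsHorizontalField I J F X → IsHorizontalField I J F Y →
        IsVerticalField I J F V → ∀ p : M,
        inner ℝ (oneillA I J F X (S.B J F Y) p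
              - oneillA I J F Y (S.B J F X) p)
            (S.phi p (V p))
          = inner ℝ (S.C J F Y p)
                (S.phi p (oneillA I J F X V p))
            - inner ℝ (S.C J F X p)
                (S.phi p (oneillA I J F Y V p))] := by
  tfae_have 3 ↔ 2 := by
    refine forall₃_congr fun X Y V ↦ forall₃_congr fun hX hY hV ↦ forall_congr' fun p ↦ ?_
    have hφV := hanti p _ (hV.2 p)
    rw [hF.inner_secondFundamentalForm hY.2 (S.B_mem F X) hφV,
      hF.inner_secondFundamentalForm hX.2 (S.B_mem F Y) hφV, inner_sub_left]
    constructor <;> intro h <;> linarith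
  tfae_have 1 ↔ 3 := by
    rw [hF.horizontalIntegrable_iff]
    refine forall₃_congr fun X Y V ↦ forall₃_congr fun hX hY hV ↦ forall_congr' fun p ↦ ?_
    rw [hS.inner_mlieBracket hF hanti hxi hX hY hV, sub_eq_zero]
  tfae_finish

theorem theorem3
    {E : Type*} [NormedAddCommGroup E] [NormedSpace ℝ E] [FiniteDimensional ℝ E]
    {M : Type*} [TopologicalSpace M] [ChartedSpace E M] [IsManifold 𝓘(ℝ, E) ∞ M] [T2Space M]
    [RiemannianBundle (fun x : M ↦ TangentSpace 𝓘(ℝ, E) x)]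
    [IsContMDiffRiemannianBundle 𝓘(ℝ, E) ∞ E (fun x : M ↦ TangentSpace 𝓘(ℝ, E) x)]
    {E' : Type*} [NormedAddCommGroup E'] [NormedSpace ℝ E'] [FiniteDimensional ℝ E']
    {N : Type*} [TopologicalSpace N] [ChartedSpace E' N] [IsManifold 𝓘(ℝ, E') ∞ N] [T2Space N]
    [RiemannianBundle (fun y : N ↦ TangentSpace 𝓘(ℝ, E') y)]
    [IsContMDiffRiemannianBundle 𝓘(ℝ, E') ∞ E' (fun y : N ↦ TangentSpace 𝓘(ℝ, E') y)]
    (S : AlmostContactMetricStructure 𝓘(ℝ, E) M) (hS : S.IsCosymplectic)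
    (F : M → N) (hF : IsRiemannianSubmersion 𝓘(ℝ, E) 𝓘(ℝ, E') F)
    (hanti : S.IsAntiInvariant 𝓘(ℝ, E') F)
    (hxi : ∀ p, S.xi p ∈ verticalSpace 𝓘(ℝ, E) 𝓘(ℝ, E') F p) :
    List.TFAE [
      HorizontalIntegrable 𝓘(ℝ, E) 𝓘(ℝ, E') F,
      ∀ X Y V : Π x : M, TangentSpace 𝓘(ℝ, E) x,
        IsHorizontalField 𝓘(ℝ, E) 𝓘(ℝ, E') F X → IsHorizontalField 𝓘(ℝ, E) 𝓘(ℝ, E') F Y →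
        IsVerticalField 𝓘(ℝ, E) 𝓘(ℝ, E') F V → ∀ p : M,
        inner ℝ (secondFundamentalForm 𝓘(ℝ, E) 𝓘(ℝ, E') F Y (S.B 𝓘(ℝ, E') F X) p)
            (mfderiv 𝓘(ℝ, E) 𝓘(ℝ, E') F p (S.phi p (V p)))
          = inner ℝ (secondFundamentalForm 𝓘(ℝ, E) 𝓘(ℝ, E') F X (S.B 𝓘(ℝ, E') F Y) p)
              (mfderiv 𝓘(ℝ, E) 𝓘(ℝ, E') F p (S.phi p (V p)))
            + inner ℝ (S.C 𝓘(ℝ, E') F Y p)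
                (S.phi p (oneillA 𝓘(ℝ, E) 𝓘(ℝ, E') F X V p))
            - inner ℝ (S.C 𝓘(ℝ, E') F X p)
                (S.phi p (oneillA 𝓘(ℝ, E) 𝓘(ℝ, E') F Y V p)),
      ∀ X Y V : Π x : M, TangentSpace 𝓘(ℝ, E) x,
        IsHorizontalField 𝓘(ℝ, E) 𝓘(ℝ, E') F X → IsHorizontalField 𝓘(ℝ, E) 𝓘(ℝ, E') F Y →
        IsVerticalField 𝓘(ℝ, E) 𝓘(ℝ, E') F V → ∀ p : M,
        inner ℝ (oneillA 𝓘(ℝ, E) 𝓘(ℝ, E') F X (S.B 𝓘(ℝ, E') F Y) p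
              - oneillA 𝓘(ℝ, E) 𝓘(ℝ, E') F Y (S.B 𝓘(ℝ, E') F X) p)
            (S.phi p (V p))
          = inner ℝ (S.C 𝓘(ℝ, E') F Y p)
                (S.phi p (oneillA 𝓘(ℝ, E) 𝓘(ℝ, E') F X V p))
            - inner ℝ (S.C 𝓘(ℝ, E') F X p)
                (S.phi p (oneillA 𝓘(ℝ, E) 𝓘(ℝ, E') F Y V p))] :=
  theorem3_general S hS F hF.isRiemannianMap hanti hxi
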